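/- There is an absolute constant $c>0$ such that for every prime $p$ there exists $n_0\in\mathbb N$ such that for all $n\ge n_0$, all $\varepsilon\in\left(0,\frac{p-1}{2p}\right]$ and all integers $t\ge 1$ the following holds. Every $t$-online-erasure-resilient $\varepsilon$-tester for homomorphism of functions $f:\mathbb F_p^n\to\mathbb F_p$ makes, in the worst case, at least $c\log_p t$ queries; that is, if it makes at most $q$ queries in every execution, then $q\ge c\log_p t$. Here the tester is a randomized, adaptive query algorithm that eventually accepts or rejects. It accesses $f$ through an oracle: a query $x$ is answered by $f(x)$ if $x$ has not been erased, and by the symbol $\perp$ otherwise. Initially nothing is erased; after each answered query a (fixed-rate) $t$-online-erasure adversary, who knows $f$ and all queries made so far, may permanently erase the values of $f$ at up to $t$ points of its choice. The algorithm is a $t$-online-erasure-resilient $\varepsilon$-tester for homomorphism if, for every such adversary, it accepts with probability at least $2/3$ every $f$ that is a group homomorphism, and rejects with probability at least $2/3$ every $f$ that is $\varepsilon$-far from all of them, i.e. with $\min_h \Pr_x[f(x)\ne h(x)]>\varepsilon$, where $h$ ranges over the homomorphisms $\mathbb F_p^n\to\mathbb F_p$, $x$ is uniform in $\mathbb F_p^n$,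 and the acceptance and rejection probabilities are over the tester's coins. -/

import Mathlib

namespace OnlineTesting

/-- A deterministic adaptive query algorithm on functions `X → Y`, as a decision tree: it either
halts with a verdict (`true` = accept, `false` = reject), or queries a point `x` and continues
according to the answer, which is a value `some y` or the erasure symbol `none`.
When `X` and `Y` are finite there are only countably many such trees, so that randomized algorithms
are exactly the probability mass functions on them. -/
inductive QueryAlg (X Y : Type) : Type
  | halt (verdict : Bool) : QueryAlg X Y
  | query (x : X) (next : Option Y → QueryAlg X Y) : QueryAlg X Y

/-- A (deterministic) erasure strategy: given the list of all queries made so far (most recent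
first), the set of points whose values are erased after the most recent query has been answered.
In the definitions below a strategy is chosen after the input function, so it may depend on it
(and hence also on all the answers given so far). -/
abbrev Strategy (X : Type) : Type := List X → Finset X

/-- The strategy is a fixed-rate `t`-online-erasure adversary: after each answered query
it erases at most `t` values. -/
def Strategy.HasRate {X : Type} (S : Strategy X) (t : ℕ) : Prop :=
  ∀ hist : List X, (S hist).card ≤ t

/-- Execution of an algorithm on the input `f` against the strategy `S`, from the state in which
the queries `hist` have been made (most recent first) and the points of `E` have been erased.
A query to an erased point is answered by `none`, any other query `x` by `some (f x)`; after the
answer the strategy erases further points, and erasures are permanent.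
The result is the verdict together with the number of queries made. -/
def exec {X Y : Type} [DecidableEq X] (f : X → Y) (S : Strategy X) :
    QueryAlg X Y → List X → Finset X → Bool × ℕ
  | .halt b, _, _ => (b, 0)
  | .query x next, hist, E =>
      let r := exec f S (next (if x ∈ E then none else some (f x)))
        (x :: hist) (E ∪ S (x :: hist))
      (r.1, r.2 + 1)

/-- The verdict on input `f` against `S`; initially nothing has been queried or erased. -/
def verdict {X Y : Type} [DecidableEq X] (f : X → Y) (S : Strategy X) (A : QueryAlg X Y) : Bool :=
  (exec f S A [] ∅).1

/-- The number of queries made on input `f` against `S`. -/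
def numQueries {X Y : Type} [DecidableEq X] (f : X → Y) (S : Strategy X) (A : QueryAlg X Y) : ℕ :=
  (exec f S A [] ∅).2

/-- The relative Hamming distance `Pr_x [f x ≠ g x]`. -/
noncomputable def relDist {X Y : Type} [Fintype X] [DecidableEq Y] (f g : X → Y) : ℝ :=
  (hammingDist f g : ℝ) / (Fintype.card X : ℝ)

/-- The distance from a function to a (nonempty) property. -/
noncomputable def distTo {X Y : Type} [Fintype X] [DecidableEq Y]
    (f : X → Y) (P : Set (X → Y)) : ℝ :=
  sInf (relDist f '' P)

/-- The randomized algorithm `T` is an `ε`-tester for the property `P` that works in the presence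
of every fixed-rate `t`-online-erasure adversary. -/
structure IsOnlineErasureTester {X Y : Type} [Fintype X] [DecidableEq X] [DecidableEq Y]
    (t : ℕ) (ε : ℝ) (P : Set (X → Y)) (T : PMF (QueryAlg X Y)) : Prop where
  accepts : ∀ f ∈ P, ∀ S : Strategy X, S.HasRate t → 2 / 3 ≤ (T.map (verdict f S)) true
  rejects : ∀ f, ε < distTo f P → ∀ S : Strategy X, S.HasRate t →
    2 / 3 ≤ (T.map (verdict f S)) false

/-- In every execution (any input, any fixed-rate `t`-online-erasure adversary, any outcome of
the coins that has positive probability) `T` makes at most `q` queries. -/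
def MakesAtMost {X Y : Type} [DecidableEq X] (t q : ℕ) (T : PMF (QueryAlg X Y)) : Prop :=
  ∀ A ∈ T.support, ∀ f : X → Y, ∀ S : Strategy X, S.HasRate t → numQueries f S A ≤ q

/-- The set of all group homomorphisms from `G` to `H`. -/
def Hom (G H : Type) [AddGroup G] [AddGroup H] : Set (G → H) :=
  {h | ∀ x y : G, h (x + y) = h x + h y}

end OnlineTesting

/-! If `t ≥ |F| ^ q`, the adversary can erase the span of all queried points after each of `q`
queries. Only a query outside the span of the earlier ones, or a first look at `0`, then gets an
answer. At linearly independent points a uniformly random linear functional takes independent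
uniform values, and so does a uniformly random function vanishing at `0`, so the verdict has the
same distribution on both (`sum_exec_eq`, `card_verdict_mul_card`).

More than half of the functions vanishing at `0` are far from every functional, by an
exponential-moment bound and a union bound (`card_close_lt`). A tester would accept a random
functional with probability at least 2/3, but a random function vanishing at `0` with probability
less than 2/3. Hence `t < p ^ q`, which gives the bound with `c = 1`. -/

namespace OnlineTesting

open Finset

/-! ### The span-erasing adversary and indistinguishability. -/

section Span

variable {F V : Type} [Field F] [Fintype F] [AddCommGroup V] [Module F V] [Fintype V]
  [DecidableEq V]

open Classical in
/-- The strategy that erases the whole span of the points queried so far, as long as this does not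
exceed the rate `t`. -/
noncomputable def spanStrategy (F : Type) {V : Type} [Field F] [AddCommGroup V] [Module F V]
    [Fintype V] (t : ℕ) : Strategy V := fun hist =>
  if (univ.filter (· ∈ Submodule.span F {x | x ∈ hist})).card ≤ t then
    univ.filter (· ∈ Submodule.span F {x | x ∈ hist}) else ∅

omit [Fintype F] [DecidableEq V] in
theorem spanStrategy_hasRate (t : ℕ) : (spanStrategy F t : Strategy V).HasRate t := by
  intro hist
  unfold spanStrategy
  split_ifs with h
  · exact h
  · simp

open Classical in
theorem card_span_le (hist : List V) :
    (univ.filter (· ∈ Submodule.span F {x | x ∈ hist})).card ≤ Fintype.card F ^ hist.length := by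
  rw [← Fintype.card_subtype]
  have h1 : Fintype.card (Submodule.span F {x | x ∈ hist}) =
      Fintype.card F ^ Module.finrank F (Submodule.span F {x | x ∈ hist}) :=
    Module.card_eq_pow_finrank
  have h2 : Module.finrank F (Submodule.span F {x | x ∈ hist}) ≤ hist.length := by
    have h3 : {x | x ∈ hist} = (hist.toFinset : Set V) := by ext; simp
    rw [h3]
    exact (finrank_span_finset_le_card _).trans (List.toFinset_card_le _)
  exact h1.le.trans (Nat.pow_le_pow_right Fintype.card_pos h2)

/-- The span of at most `q` points has at most `|F| ^ q ≤ t` elements, so the rate limit never stops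
the adversary. -/
theorem mem_spanStrategy {t q : ℕ} (ht : Fintype.card F ^ q ≤ t) {hist : List V}
    (hh : hist.length ≤ q) (z : V) :
    z ∈ spanStrategy F t hist ↔ z ∈ Submodule.span F {x | x ∈ hist} := by
  classical
  unfold spanStrategy
  rw [if_pos]
  · simp
  · exact (card_span_le hist).trans ((Nat.pow_le_pow_right Fintype.card_pos hh).trans ht)

/-- A space of functions vanishing at `0` is separating if its elements take independent values at
linearly independent points. -/
structure IsSeparating (K : Submodule F (V → F)) : Prop where
  map_zero : ∀ k ∈ K, k 0 = 0
  exists_eq_one : ∀ (W : Submodule F V), ∀ x ∉ W, ∃ k ∈ K, (∀ w ∈ W, k w = 0) ∧ k x = 1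

open Classical in
/-- The functions in `K` that vanish on `L`. -/
noncomputable def vanishing (K : Submodule F (V → F)) (L : Finset V) : Finset (V → F) :=
  univ.filter fun k => k ∈ K ∧ ∀ w ∈ L, k w = 0

omit [AddCommGroup V] [Module F V] in
theorem mem_vanishing {K : Submodule F (V → F)} {L : Finset V} {k : V → F} :
    k ∈ vanishing K L ↔ k ∈ K ∧ ∀ w ∈ L, k w = 0 := by
  simp [vanishing]

-- Sorting by the value `y` at `x` splits the space into cosets of the functions that also vanish at
-- `x`, with representatives `y • l`.
omit [AddCommGroup V] [Module F V] in
theorem sum_vanishing {K : Submodule F (V → F)} {L : Finset V} {x : V} {l : V → F}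
    (hl : l ∈ vanishing K L) (hx : l x = 1) (Φ : (V → F) → ℚ) :
    ∑ k ∈ vanishing K L, Φ k = ∑ y : F, ∑ k ∈ vanishing K (insert x L), Φ (y • l + k) := by
  classical
  rw [mem_vanishing] at hl
  rw [← Finset.sum_fiberwise (vanishing K L) (fun k => k x)]
  refine Finset.sum_congr rfl fun y _ => ?_
  refine Finset.sum_bij' (fun k _ => k - y • l) (fun k _ => y • l + k) ?_ ?_ ?_ ?_ ?_
  · intro k hk
    rw [mem_filter, mem_vanishing] at hk
    rw [mem_vanishing]
    refine ⟨K.sub_mem hk.1.1 (K.smul_mem _ hl.1), fun w hw => ?_⟩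
    rcases Finset.mem_insert.1 hw with rfl | hw
    · simp [hx, hk.2]
    · simp [hk.1.2 w hw, hl.2 w hw]
  · intro k hk
    rw [mem_vanishing] at hk
    rw [mem_filter, mem_vanishing]
    refine ⟨⟨K.add_mem (K.smul_mem _ hl.1) hk.1, fun w hw => ?_⟩, ?_⟩
    · simp [hk.2 w (Finset.mem_insert_of_mem hw), hl.2 w hw]
    · simp [hx, hk.2 x (Finset.mem_insert_self _ _)]
  · intro k _; simp
  · intro k _; simp
  · intro k _; simp

omit [AddCommGroup V] [Module F V] in
theorem card_vanishing {K : Submodule F (V → F)} {L : Finset V} {x : V} {l : V → F}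
    (hl : l ∈ vanishing K L) (hx : l x = 1) :
    ((vanishing K L).card : ℚ) = Fintype.card F * (vanishing K (insert x L)).card := by
  have := sum_vanishing hl hx (fun _ => 1)
  simpa using this

/-- The expectation of `φ` of the verdict when every answer at an unerased nonzero point is
uniformly random and the answer at an unerased zero is `0`. -/
noncomputable def idealRate (S : Strategy V) (φ : Bool → ℚ) :
    QueryAlg V F → List V → Finset V → ℚ
  | .halt v, _, _ => φ v
  | .query x next, hist, E =>
      if x ∈ E then idealRate S φ (next none) (x :: hist) (E ∪ S (x :: hist))
      else open Classical in if x = 0 then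
        idealRate S φ (next (some 0)) (x :: hist) (E ∪ S (x :: hist))
      else (∑ y : F, idealRate S φ (next (some y)) (x :: hist) (E ∪ S (x :: hist))) /
        Fintype.card F

omit [Fintype F] [Fintype V] [DecidableEq V] in
theorem span_cons (x : V) (hist : List V) :
    Submodule.span F {z | z ∈ x :: hist} =
      Submodule.span F {x} ⊔ Submodule.span F {z | z ∈ hist} := by
  rw [← Submodule.span_union]
  congr 1
  ext; simp

/-- The functions consistent with the answers so far form a coset `g + vanishing K L`, with `L`
spanning the queried points. The right side depends on `K` only through a cardinality. Erasures are
compared with the span away from `0` only, since at the start nothing is erased while the span is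
`{0}`. -/
theorem sum_exec_eq {K : Submodule F (V → F)} (hK : IsSeparating K) {q : ℕ} {S : Strategy V}
    (hS : ∀ hist : List V, hist.length ≤ q →
      ∀ z, z ∈ S hist ↔ z ∈ Submodule.span F {x | x ∈ hist}) (φ : Bool → ℚ) (A : QueryAlg V F) :
    ∀ (hist : List V) (E L : Finset V) (g : V → F), g 0 = 0 →
      (∀ z, z ≠ 0 → (z ∈ E ↔ z ∈ Submodule.span F {x | x ∈ hist})) →
      Submodule.span F (L : Set V) = Submodule.span F {x | x ∈ hist} →
      (∀ k ∈ vanishing K L, hist.length + (exec (g + k) S A hist E).2 ≤ q) →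
      ∑ k ∈ vanishing K L, φ (exec (g + k) S A hist E).1 =
        (vanishing K L).card * idealRate S φ A hist E := by
  classical
  induction A with
  | halt v =>
    intro hist E L g _ _ _ _
    simp [exec, idealRate]
  | query x next ih =>
    intro hist E L g hg hE hL hq
    have hlen : (x :: hist).length ≤ q := by
      have := hq 0 (mem_vanishing.2 ⟨K.zero_mem, by simp⟩)
      simp only [exec] at this
      simp only [List.length_cons]
      omega
    have hle : Submodule.span F {z | z ∈ hist} ≤ Submodule.span F {z | z ∈ x :: hist} :=
      Submodule.span_mono fun z hz => List.mem_cons_of_mem _ hz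
    have hE' : ∀ z, z ≠ 0 →
        (z ∈ E ∪ S (x :: hist) ↔ z ∈ Submodule.span F {y | y ∈ x :: hist}) := by
      intro z hz
      rw [Finset.mem_union, hS _ hlen, hE z hz]
      exact ⟨fun h => h.elim (fun h => hle h) id, Or.inr⟩
    -- Inside the span the answer is the same for all `k`: it is `none`, or `some 0` at an unerased
    -- zero. Outside, it is uniform over `F`, and the coset splits.
    by_cases hx : x ∈ Submodule.span F {z | z ∈ hist}
    · have hL' : Submodule.span F (L : Set V) = Submodule.span F {y | y ∈ x :: hist} := by
        rw [span_cons, hL, eq_comm, sup_eq_right, Submodule.span_singleton_le_iff_mem]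
        exact hx
      obtain ⟨o, ho, ho'⟩ : ∃ o, (∀ k ∈ vanishing K L,
          (if x ∈ E then none else some ((g + k) x)) = o) ∧
          idealRate S φ (.query x next) hist E =
            idealRate S φ (next o) (x :: hist) (E ∪ S (x :: hist)) := by
        by_cases hxE : x ∈ E
        · exact ⟨none, by simp [hxE], by simp [idealRate, hxE]⟩
        · have h0 : x = 0 := by
            by_contra h0
            exact hxE ((hE x h0).2 hx)
          subst h0
          refine ⟨some 0, fun k hk => ?_, by simp [idealRate, hxE]⟩
          simp [hxE, hg, hK.map_zero k (mem_vanishing.1 hk).1]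
      rw [ho', ← ih o (x :: hist) (E ∪ S (x :: hist)) L g hg hE' hL']
      · refine Finset.sum_congr rfl fun k hk => ?_
        simp only [exec]
        rw [ho k hk]
      · intro k hk
        have := hq k hk
        simp only [exec] at this
        rw [ho k hk] at this
        simp only [List.length_cons]
        omega
    · have hx0 : x ≠ 0 := by rintro rfl; exact hx (Submodule.zero_mem _)
      have hxE : x ∉ E := fun h => hx ((hE x hx0).1 h)
      obtain ⟨l, hlK, hlW, hlx⟩ := hK.exists_eq_one _ x hx
      have hl : l ∈ vanishing K L := mem_vanishing.2 ⟨hlK, fun w hw =>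
        hlW w (hL ▸ Submodule.subset_span hw)⟩
      have hL' : Submodule.span F ((insert x L : Finset V) : Set V) =
          Submodule.span F {y | y ∈ x :: hist} := by
        rw [span_cons, Finset.coe_insert, Submodule.span_insert, hL]
      have hval : ∀ (y : F), ∀ k ∈ vanishing K (insert x L),
          (g + (y • l + k)) x = g x + y := by
        intro y k hk
        simp [hlx, (mem_vanishing.1 hk).2 x (Finset.mem_insert_self _ _)]
      have hmem : ∀ (y : F), ∀ k ∈ vanishing K (insert x L), y • l + k ∈ vanishing K L := by
        intro y k hk
        rw [mem_vanishing] at hk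
        refine mem_vanishing.2 ⟨K.add_mem (K.smul_mem _ hlK) hk.1, fun w hw => ?_⟩
        simp [hk.2 w (Finset.mem_insert_of_mem hw), (mem_vanishing.1 hl).2 w hw]
      have key : ∀ y : F, ∑ k ∈ vanishing K (insert x L),
          φ (exec (g + (y • l + k)) S (.query x next) hist E).1 =
          (vanishing K (insert x L)).card *
            idealRate S φ (next (some (g x + y))) (x :: hist) (E ∪ S (x :: hist)) := by
        intro y
        rw [← ih (some (g x + y)) (x :: hist) (E ∪ S (x :: hist)) (insert x L) (g + y • l)
          (by simp [hg, hK.map_zero l hlK]) hE' hL']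
        · refine Finset.sum_congr rfl fun k hk => ?_
          simp only [exec, if_neg hxE]
          rw [hval y k hk, add_assoc]
        · intro k hk
          have := hq _ (hmem y k hk)
          simp only [exec, if_neg hxE] at this
          rw [hval y k hk] at this
          rw [add_assoc]
          simp only [List.length_cons]
          omega
      -- The offset `g x` only permutes the possible answers.
      have hsum : ∑ y, idealRate S φ (next (some (g x + y))) (x :: hist) (E ∪ S (x :: hist)) =
          ∑ y, idealRate S φ (next (some y)) (x :: hist) (E ∪ S (x :: hist)) :=
        Equiv.sum_comp (Equiv.addLeft (g x))
          (fun y => idealRate S φ (next (some y)) (x :: hist) (E ∪ S (x :: hist)))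
      rw [sum_vanishing hl hlx, Finset.sum_congr rfl fun y _ => key y, ← Finset.mul_sum,
        card_vanishing hl hlx, hsum]
      have hF : (Fintype.card F : ℚ) ≠ 0 := by exact_mod_cast Fintype.card_ne_zero
      simp only [idealRate, if_neg hxE, if_neg hx0]
      field_simp

/-- An algorithm with `q` queries cannot tell two separating spaces of functions apart when the
span of its queries gets erased. -/
theorem card_verdict_mul_card {K K' : Submodule F (V → F)} (hK : IsSeparating K)
    (hK' : IsSeparating K') {t q : ℕ} (ht : Fintype.card F ^ q ≤ t) {A : QueryAlg V F}
    (hA : ∀ f : V → F, numQueries f (spanStrategy F t) A ≤ q) (b : Bool) :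
    ((vanishing K ∅).filter fun f => verdict f (spanStrategy F t) A = b).card *
        (vanishing K' ∅).card =
      ((vanishing K' ∅).filter fun f => verdict f (spanStrategy F t) A = b).card *
        (vanishing K ∅).card := by
  have main : ∀ M : Submodule F (V → F), IsSeparating M →
      (((vanishing M ∅).filter fun f => verdict f (spanStrategy F t) A = b).card : ℚ) =
        (vanishing M ∅).card *
          idealRate (spanStrategy F t) (fun v => if v = b then 1 else 0) A [] ∅ := by
    intro M hM
    rw [← sum_exec_eq hM (q := q) (fun hist hh z => mem_spanStrategy ht hh z) _ A [] ∅ ∅ 0 rfl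
      (by intro z hz; simpa using hz) (by simp)
      (by intro k _; simpa [numQueries] using hA k), Finset.card_filter]
    push_cast
    refine Finset.sum_congr rfl fun k _ => ?_
    rw [zero_add]
    rfl
  have h1 := main K hK
  have h2 := main K' hK'
  have : ((((vanishing K ∅).filter fun f => verdict f (spanStrategy F t) A = b).card *
        (vanishing K' ∅).card : ℕ) : ℚ) =
      (((vanishing K' ∅).filter fun f => verdict f (spanStrategy F t) A = b).card *
        (vanishing K ∅).card : ℕ) := by
    push_cast
    rw [h1, h2]
    ring
  exact_mod_cast this

end Span

/-! ### The two separating spaces: linear functionals and functions vanishing at zero. -/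

section Separating

variable {F V : Type} [Field F] [AddCommGroup V] [Module F V]

/-- The linear functionals, as a space of functions. -/
def linearFunctionals (F V : Type) [Field F] [AddCommGroup V] [Module F V] :
    Submodule F (V → F) :=
  LinearMap.range (LinearMap.ltoFun F V F F)

theorem isSeparating_linearFunctionals : IsSeparating (linearFunctionals F V) where
  map_zero := by
    rintro _ ⟨l, rfl⟩
    exact l.map_zero
  exists_eq_one W x hx := by
    obtain ⟨l, hlx, hlW⟩ := Submodule.exists_le_ker_of_notMem hx
    refine ⟨⇑((l x)⁻¹ • l), ⟨(l x)⁻¹ • l, rfl⟩, fun w hw => ?_, ?_⟩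
    · have : l w = 0 := hlW hw
      simp [this]
    · simp [hlx]

/-- The functions vanishing at `0`. -/
def zeroAtZero (F V : Type) [Field F] [AddCommGroup V] : Submodule F (V → F) :=
  LinearMap.ker (LinearMap.proj (0 : V))

omit [Module F V] in
theorem mem_zeroAtZero {k : V → F} : k ∈ zeroAtZero F V ↔ k 0 = 0 := Iff.rfl

theorem isSeparating_zeroAtZero : IsSeparating (zeroAtZero F V) where
  map_zero _ hk := hk
  exists_eq_one W x hx := by
    classical
    have hne : ∀ w ∈ W, w ≠ x := by rintro w hw rfl; exact hx hw
    refine ⟨Pi.single x 1, ?_, fun w hw => ?_, by simp⟩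
    · rw [mem_zeroAtZero, Pi.single_eq_of_ne (hne 0 W.zero_mem)]
    · rw [Pi.single_eq_of_ne (hne w hw)]

theorem mem_linearFunctionals_iff_mem_Hom {p : ℕ} [Fact p.Prime] {W : Type} [AddCommGroup W]
    [Module (ZMod p) W] {h : W → ZMod p} :
    h ∈ linearFunctionals (ZMod p) W ↔ h ∈ Hom W (ZMod p) := by
  constructor
  · rintro ⟨l, rfl⟩
    exact fun x y => l.map_add x y
  · intro hh
    exact ⟨AddMonoidHom.toZModLinearMap p (AddMonoidHom.mk' h hh), rfl⟩

theorem card_vanishing_linearFunctionals [Fintype F] [Fintype V] [DecidableEq V] :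
    (vanishing (linearFunctionals F V) ∅).card ≤ Fintype.card V := by
  classical
  have h1 : (vanishing (linearFunctionals F V) ∅).card =
      Fintype.card (linearFunctionals F V) := by
    rw [Fintype.card_of_subtype _ fun k => ?_]
    simp [mem_vanishing]
  have h2 : Fintype.card (linearFunctionals F V) =
      Fintype.card F ^ Module.finrank F (linearFunctionals F V) := Module.card_eq_pow_finrank
  have h3 : Fintype.card V = Fintype.card F ^ Module.finrank F V := Module.card_eq_pow_finrank
  rw [h1, h2, h3, ← Subspace.dual_finrank_eq (K := F) (V := V)]
  exact Nat.pow_le_pow_right Fintype.card_pos (LinearMap.finrank_range_le _)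

end Separating

/-! ### Most functions vanishing at zero are far from linear. -/

section Tail

variable {F V : Type} [Field F] [Fintype F] [DecidableEq F] [AddCommGroup V] [Module F V]
  [Fintype V] [DecidableEq V]

omit [DecidableEq F] [Module F V] in
theorem vanishing_zeroAtZero :
    vanishing (zeroAtZero F V) ∅ =
      Fintype.piFinset fun x : V => if x = 0 then {0} else (univ : Finset F) := by
  ext k
  rw [mem_vanishing, mem_zeroAtZero, Fintype.mem_piFinset]
  constructor
  · rintro ⟨h, -⟩ x
    split_ifs with hx
    · simp [hx, h]
    · simp
  · intro h
    exact ⟨by simpa using h 0, by simp⟩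

omit [DecidableEq F] [Module F V] in
theorem card_vanishing_zeroAtZero :
    (vanishing (zeroAtZero F V) ∅).card = Fintype.card F ^ (Fintype.card V - 1) := by
  rw [vanishing_zeroAtZero, Fintype.card_piFinset, ← Finset.mul_prod_erase univ _ (mem_univ 0),
    Finset.prod_congr rfl (g := fun _ => Fintype.card F)]
  · simp
  · intro x hx
    simp [Finset.ne_of_mem_erase hx]

-- The moment generating function of the support size: the sum factors over the points, and the
-- point `0` contributes 1.
omit [Module F V] in
theorem sum_half_pow_hammingNorm :
    ∑ k ∈ vanishing (zeroAtZero F V) ∅, (1 / 2 : ℝ) ^ hammingNorm k =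
      ((Fintype.card F + 1) / 2 : ℝ) ^ (Fintype.card V - 1) := by
  have h1 : ∀ k : V → F, (1 / 2 : ℝ) ^ hammingNorm k =
      ∏ x, if k x = 0 then (1 : ℝ) else 1 / 2 := by
    intro k
    rw [Finset.prod_ite]
    simp [hammingNorm]
  have h2 : ∑ y : F, (if y = 0 then (1 : ℝ) else 1 / 2) = (Fintype.card F + 1) / 2 := by
    have : ∀ y : F, (if y = 0 then (1 : ℝ) else 1 / 2) = 1 / 2 + if y = 0 then 1 / 2 else 0 := by
      intro y; split_ifs <;> norm_num
    simp_rw [this, Finset.sum_add_distrib]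
    simp
    ring
  simp_rw [h1]
  rw [vanishing_zeroAtZero, ← Finset.prod_univ_sum _ fun _ y => if y = 0 then (1 : ℝ) else 1 / 2,
    ← Finset.mul_prod_erase univ _ (mem_univ 0),
    Finset.prod_congr rfl (g := fun _ => ((Fintype.card F + 1) / 2 : ℝ))]
  · simp [div_pow]
  · intro x hx
    rw [if_neg (Finset.ne_of_mem_erase hx), h2]

/-- With `m = |F|` and `N = |V|`, the first two factors bound the number of functions of small
support; `2 * N` pays for the union bound over at most `N` functionals and for the share one half.
-/
theorem exp_bound {m : ℝ} (hm : 2 ≤ m) {N : ℕ} (hN : 2048 ≤ N) :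
    ((m + 1) / 2) ^ (N - 1) * (2 : ℝ) ^ (N * ((m - 1) / (2 * m))) * (2 * N) < m ^ (N - 1) := by
  have hm0 : 0 < m := by linarith
  set a := (m - 1) / m with ha
  have ha1 : a ≤ 1 := by rw [ha, div_le_one hm0]; linarith
  have ha2 : 1 / 2 ≤ a := by rw [ha, div_le_div_iff₀ (by norm_num) hm0]; linarith
  have e1 : (m + 1) / 2 = m * (1 - a / 2) := by rw [ha]; field_simp; ring
  have e2 : (N : ℝ) * ((m - 1) / (2 * m)) = N * a / 2 := by rw [ha]; field_simp
  have hNr : (2048 : ℝ) ≤ N := by exact_mod_cast hN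
  have b1 : (1 - a / 2) ^ (N - 1) ≤ Real.exp (-(a / 2) * (N - 1)) := by
    have : 1 - a / 2 ≤ Real.exp (-(a / 2)) := by
      linarith [Real.add_one_le_exp (-(a / 2))]
    calc (1 - a / 2) ^ (N - 1) ≤ Real.exp (-(a / 2)) ^ (N - 1) :=
          pow_le_pow_left₀ (by linarith) this _
      _ = Real.exp (-(a / 2) * (N - 1)) := by
          rw [← Real.exp_nat_mul, Nat.cast_sub (by omega)]
          push_cast
          ring_nf
  have b2 : (2 : ℝ) ^ (N * a / 2) = Real.exp (Real.log 2 * (N * a / 2)) :=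
    Real.rpow_def_of_pos (by norm_num) _
  -- Since `log 2 < 0.6932` and `1 / 2 ≤ a ≤ 1`, the exponent is at most `1 / 2 - (1 - 0.6932) * N /
  -- 4`, and `0.3068 / 4 = 0.0767`.
  have b3 : (1 - a / 2) ^ (N - 1) * (2 : ℝ) ^ (N * a / 2) ≤ Real.exp (1 / 2 - 0.0767 * N) := by
    rw [b2]
    refine (mul_le_mul_of_nonneg_right b1 (Real.exp_pos _).le).trans ?_
    rw [← Real.exp_add, Real.exp_le_exp]
    have hlog := Real.log_two_lt_d9
    have hNa : (N : ℝ) * (1 / 2) ≤ N * a := mul_le_mul_of_nonneg_left ha2 (by linarith)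
    have : Real.log 2 * (N * a / 2) ≤ 0.6932 * (N * a / 2) :=
      mul_le_mul_of_nonneg_right (by linarith) (by linarith)
    linarith
  have b4 : Real.exp (1 / 2 - 0.0767 * N) * (2 * N) < 1 := by
    have h1 : Real.exp (1 / 2) ≤ 2 := by
      have : Real.exp (1 / 2) ^ 2 ≤ 2 ^ 2 := by
        rw [← Real.exp_nat_mul]
        norm_num
        linarith [Real.exp_one_lt_d9]
      exact le_of_sq_le_sq this (by norm_num)
    -- The quadratic term is about `0.0029 * N ^ 2`, which exceeds `4 * N` once `N ≥ 2048`.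
    have h2 := Real.quadratic_le_exp_of_nonneg (x := 0.0767 * N) (by linarith)
    have h3 : 4 * (N : ℝ) < Real.exp (0.0767 * N) := by nlinarith
    rw [Real.exp_sub, div_mul_eq_mul_div, div_lt_one (Real.exp_pos _)]
    nlinarith
  rw [e1, e2, mul_pow]
  have hp : 0 < m ^ (N - 1) := by positivity
  calc m ^ (N - 1) * (1 - a / 2) ^ (N - 1) * 2 ^ (N * a / 2) * (2 * N)
      = m ^ (N - 1) * (((1 - a / 2) ^ (N - 1) * 2 ^ (N * a / 2)) * (2 * N)) := by ring
    _ ≤ m ^ (N - 1) * (Real.exp (1 / 2 - 0.0767 * N) * (2 * N)) := by gcongr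
    _ < m ^ (N - 1) := by nlinarith

omit [Module F V] in
/-- Few functions vanishing at `0` have small support. -/
theorem card_hammingNorm_le (hN : 2048 ≤ Fintype.card V) :
    (((vanishing (zeroAtZero F V) ∅).filter fun k => (hammingNorm k : ℝ) ≤
        Fintype.card V * (((Fintype.card F : ℝ) - 1) / (2 * Fintype.card F))).card : ℝ) *
      (2 * Fintype.card V) < (vanishing (zeroAtZero F V) ∅).card := by
  set B : ℝ := Fintype.card V * (((Fintype.card F : ℝ) - 1) / (2 * Fintype.card F)) with hB
  set P := vanishing (zeroAtZero F V) ∅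
  have hm : (2 : ℝ) ≤ Fintype.card F := by exact_mod_cast Fintype.one_lt_card (α := F)
  -- Markov's inequality for `(1 / 2) ^ hammingNorm k`.
  have h1 : ((P.filter fun k => (hammingNorm k : ℝ) ≤ B).card : ℝ) * (1 / 2 : ℝ) ^ B ≤
      ((Fintype.card F + 1) / 2 : ℝ) ^ (Fintype.card V - 1) := by
    rw [← sum_half_pow_hammingNorm, ← nsmul_eq_mul]
    refine (Finset.card_nsmul_le_sum _ (fun k => (1 / 2 : ℝ) ^ hammingNorm k) _ ?_).trans
      (Finset.sum_le_sum_of_subset_of_nonneg (Finset.filter_subset _ _)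
        fun _ _ _ => by positivity)
    intro k hk
    rw [← Real.rpow_natCast]
    exact Real.rpow_le_rpow_of_exponent_ge (by norm_num) (by norm_num) (Finset.mem_filter.1 hk).2
  have h2 : (1 / 2 : ℝ) ^ B * 2 ^ B = 1 := by
    rw [← Real.mul_rpow (by norm_num) (by norm_num)]
    norm_num
  have h3 : ((P.filter fun k => (hammingNorm k : ℝ) ≤ B).card : ℝ) ≤
      ((Fintype.card F + 1) / 2 : ℝ) ^ (Fintype.card V - 1) * 2 ^ B := by
    have := mul_le_mul_of_nonneg_right h1 (by positivity : (0 : ℝ) ≤ 2 ^ B)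
    rwa [mul_assoc, h2, mul_one] at this
  refine (mul_le_mul_of_nonneg_right h3 (by positivity)).trans_lt ?_
  rw [card_vanishing_zeroAtZero]
  push_cast
  exact exp_bound hm hN

open Classical in
/-- Fewer than half of the functions vanishing at `0` are close to a linear functional. -/
theorem card_close_lt (hN : 2048 ≤ Fintype.card V) :
    (((vanishing (zeroAtZero F V) ∅).filter fun k => ∃ h ∈ linearFunctionals F V,
        (hammingDist k h : ℝ) ≤
          Fintype.card V * (((Fintype.card F : ℝ) - 1) / (2 * Fintype.card F))).card : ℝ) * 2 <
      (vanishing (zeroAtZero F V) ∅).card := by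
  classical
  set B : ℝ := Fintype.card V * (((Fintype.card F : ℝ) - 1) / (2 * Fintype.card F)) with hB
  set P := vanishing (zeroAtZero F V) ∅
  set L := vanishing (linearFunctionals F V) ∅
  set Q := P.filter fun k => (hammingNorm k : ℝ) ≤ B
  -- Union bound: a function close to `h` is `h` plus a function of small support.
  have h1 : (P.filter fun k => ∃ h ∈ linearFunctionals F V, (hammingDist k h : ℝ) ≤ B) ⊆
      (L ×ˢ Q).image fun a => a.1 + a.2 := by
    intro k hk
    obtain ⟨hkP, h, hh, hd⟩ := Finset.mem_filter.1 hk
    refine Finset.mem_image.2 ⟨(h, -h + k), Finset.mem_product.2 ⟨?_, ?_⟩, by simp⟩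
    · exact mem_vanishing.2 ⟨hh, by simp⟩
    · refine Finset.mem_filter.2 ⟨mem_vanishing.2 ⟨?_, by simp⟩, ?_⟩
      · exact Submodule.add_mem _
          (Submodule.neg_mem _ (isSeparating_linearFunctionals.map_zero h hh))
          (mem_vanishing.1 hkP).1
      · rwa [hammingDist_comm, hammingDist_eq_hammingNorm] at hd
  have h2 := (Finset.card_le_card h1).trans Finset.card_image_le
  rw [Finset.card_product] at h2
  have h3 : (P.filter fun k => ∃ h ∈ linearFunctionals F V, (hammingDist k h : ℝ) ≤ B).card ≤
      Fintype.card V * Q.card :=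
    h2.trans (Nat.mul_le_mul_right _ card_vanishing_linearFunctionals)
  have h4 : ((P.filter fun k => ∃ h ∈ linearFunctionals F V, (hammingDist k h : ℝ) ≤ B).card : ℝ) ≤
      Fintype.card V * Q.card := by exact_mod_cast h3
  have h5 : (Q.card : ℝ) * (2 * Fintype.card V) < P.card := card_hammingNorm_le hN
  linarith

end Tail

/-! ### From deterministic trees to randomized testers. -/

section Tester

theorem sum_map_verdict {X Y : Type} [DecidableEq X] (T : PMF (QueryAlg X Y)) (S : Strategy X)
    (b : Bool) (M : Finset (X → Y)) :
    ∑ f ∈ M, (T.map (verdict f S)) b =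
      ∑' A, T A * ((M.filter fun f => verdict f S A = b).card : ENNReal) := by
  simp_rw [PMF.map_apply]
  rw [← Summable.tsum_finsetSum fun _ _ => ENNReal.summable]
  refine tsum_congr fun A => ?_
  rw [Finset.card_filter]
  push_cast
  rw [Finset.mul_sum]
  refine Finset.sum_congr rfl fun f _ => ?_
  by_cases h : verdict f S A = b
  · simp [h]
  · simp [h, Ne.symm h]

theorem map_verdict_add {X Y : Type} [DecidableEq X] (T : PMF (QueryAlg X Y)) (S : Strategy X)
    (f : X → Y) :
    (T.map (verdict f S)) true + (T.map (verdict f S)) false = 1 := by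
  have := (T.map (verdict f S)).tsum_coe
  rwa [tsum_fintype, Fintype.sum_bool] at this

variable {F V : Type} [Field F] [Fintype F] [DecidableEq F] [AddCommGroup V] [Module F V]
  [Fintype V] [DecidableEq V]

-- Averages the identity for single trees over the coins; trees outside the support have weight
-- zero.
omit [DecidableEq F] in
theorem sum_map_verdict_mul_card {K K' : Submodule F (V → F)} (hK : IsSeparating K)
    (hK' : IsSeparating K') {t q : ℕ} (ht : Fintype.card F ^ q ≤ t) {T : PMF (QueryAlg V F)}
    (hT : MakesAtMost t q T) (b : Bool) :
    (∑ f ∈ vanishing K ∅, (T.map (verdict f (spanStrategy F t))) b) * (vanishing K' ∅).card =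
      (∑ f ∈ vanishing K' ∅, (T.map (verdict f (spanStrategy F t))) b) *
        (vanishing K ∅).card := by
  rw [sum_map_verdict, sum_map_verdict, ← ENNReal.tsum_mul_right, ← ENNReal.tsum_mul_right]
  refine tsum_congr fun A => ?_
  by_cases hA : A ∈ T.support
  · have := card_verdict_mul_card hK hK' ht
      (fun f => hT A hA f (spanStrategy F t) (spanStrategy_hasRate t)) b
    rw [mul_assoc, mul_assoc]
    exact congrArg (T A * ·) (by exact_mod_cast this)
  · rw [PMF.mem_support_iff, not_not] at hA
    simp [hA]

omit [Field F] [Fintype F] [AddCommGroup V] [Module F V] [DecidableEq V] in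
theorem exists_relDist_eq_distTo [Finite F] {P : Set (V → F)} (hP : P.Nonempty) (f : V → F) :
    ∃ h ∈ P, relDist f h = distTo f P :=
  (hP.image _).csInf_mem (Set.toFinite _)

/-- At rate `t ≥ |F| ^ q`, no algorithm with `q` queries tests linearity. -/
theorem not_isOnlineErasureTester {t q : ℕ} (ht : Fintype.card F ^ q ≤ t)
    (hN : 2048 ≤ Fintype.card V) {ε : ℝ}
    (hε : ε ≤ ((Fintype.card F : ℝ) - 1) / (2 * Fintype.card F)) {T : PMF (QueryAlg V F)}
    (hq : MakesAtMost t q T) :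
    ¬ IsOnlineErasureTester t ε (linearFunctionals F V : Set (V → F)) T := by
  classical
  intro hT
  set S : Strategy V := spanStrategy F t with hS
  have hrate : S.HasRate t := spanStrategy_hasRate t
  set P := vanishing (zeroAtZero F V) ∅
  set H := vanishing (linearFunctionals F V) ∅
  set a : (V → F) → ℝ := fun f => ((T.map (verdict f S)) true).toReal with ha
  set r : (V → F) → ℝ := fun f => ((T.map (verdict f S)) false).toReal with hr
  have hsum : ∀ f, a f + r f = 1 := by
    intro f
    have := congrArg ENNReal.toReal (map_verdict_add T S f)
    rwa [ENNReal.toReal_add (PMF.apply_ne_top _ _) (PMF.apply_ne_top _ _),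
      ENNReal.toReal_one] at this
  have hr0 : ∀ f, 0 ≤ r f := fun f => ENNReal.toReal_nonneg
  have two_thirds : ∀ {x : ENNReal}, x ≠ ⊤ → 2 / 3 ≤ x → (2 / 3 : ℝ) ≤ x.toReal := by
    intro x hx h
    have := ENNReal.toReal_mono hx h
    simpa using this
  have hacc : ∀ f ∈ H, 2 / 3 ≤ a f := fun f hf =>
    two_thirds (PMF.apply_ne_top _ _) (hT.accepts f (mem_vanishing.1 hf).1 S hrate)
  have hrej : ∀ f, ε < distTo f (linearFunctionals F V : Set (V → F)) → 2 / 3 ≤ r f := fun f hf =>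
    two_thirds (PMF.apply_ne_top _ _) (hT.rejects f hf S hrate)
  have hmix : (∑ f ∈ H, a f) * P.card = (∑ f ∈ P, a f) * H.card := by
    have := congrArg ENNReal.toReal (sum_map_verdict_mul_card
      (isSeparating_linearFunctionals (F := F) (V := V)) isSeparating_zeroAtZero ht hq true)
    rwa [ENNReal.toReal_mul, ENNReal.toReal_mul,
      ENNReal.toReal_sum (fun _ _ => PMF.apply_ne_top _ _),
      ENNReal.toReal_sum (fun _ _ => PMF.apply_ne_top _ _),
      ENNReal.toReal_natCast, ENNReal.toReal_natCast] at this
  have hHpos : (0 : ℝ) < H.card := by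
    exact_mod_cast Finset.card_pos.2 ⟨0, mem_vanishing.2 ⟨Submodule.zero_mem _, by simp⟩⟩
  have hH : H.card * (2 / 3 : ℝ) ≤ ∑ f ∈ H, a f := by
    rw [← nsmul_eq_mul]
    exact Finset.card_nsmul_le_sum _ _ _ hacc
  -- Indistinguishability carries the mean acceptance rate from `H` over to `P`.
  have hP : P.card * (2 / 3 : ℝ) ≤ ∑ f ∈ P, a f := by
    have := mul_le_mul_of_nonneg_right hH (Nat.cast_nonneg (α := ℝ) P.card)
    rw [hmix] at this
    refine le_of_mul_le_mul_right ?_ hHpos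
    linarith
  set C := P.filter fun k => ∃ h ∈ linearFunctionals F V, (hammingDist k h : ℝ) ≤
    Fintype.card V * (((Fintype.card F : ℝ) - 1) / (2 * Fintype.card F)) with hC
  have hclose : (C.card : ℝ) * 2 < P.card := card_close_lt hN
  have hfar : ∀ f ∈ P \ C, 2 / 3 ≤ r f := by
    intro f hf
    obtain ⟨hfP, hfC⟩ := Finset.mem_sdiff.1 hf
    refine hrej f ?_
    obtain ⟨h, hh, hd⟩ := exists_relDist_eq_distTo
      (P := (linearFunctionals F V : Set (V → F))) ⟨0, Submodule.zero_mem _⟩ f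
    by_contra hle
    refine hfC (Finset.mem_filter.2 ⟨hfP, h, hh, ?_⟩)
    have h1 : relDist f h ≤ ((Fintype.card F : ℝ) - 1) / (2 * Fintype.card F) := by
      rw [hd]
      exact (not_lt.1 hle).trans hε
    have hV : (0 : ℝ) < Fintype.card V := by exact_mod_cast Fintype.card_pos
    rw [relDist, div_le_iff₀ hV] at h1
    linarith
  have h1 : ((P \ C).card : ℝ) * (2 / 3) ≤ ∑ f ∈ P, r f := by
    rw [← nsmul_eq_mul]
    exact (Finset.card_nsmul_le_sum _ _ _ hfar).trans
      (Finset.sum_le_sum_of_subset_of_nonneg Finset.sdiff_subset fun f _ _ => hr0 f)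
  have h2 : ((P \ C).card : ℝ) + C.card = P.card := by
    exact_mod_cast Finset.card_sdiff_add_card_eq_card (Finset.filter_subset _ _)
  have h3 : ∑ f ∈ P, a f + ∑ f ∈ P, r f = P.card := by
    rw [← Finset.sum_add_distrib]
    simp [hsum]
  -- More than half of `P` is rejected with probability at least 2/3, so the rejection mass exceeds
  -- `|P| / 3`, while the acceptance mass is at least `2 * |P| / 3`.
  linarith

end Tester

end OnlineTesting

theorem theorem1p6 :
    ∃ c : ℝ, 0 < c ∧
      ∀ (p : ℕ) [Fact p.Prime], ∃ n₀ : ℕ, ∀ n : ℕ, n₀ ≤ n →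
        ∀ ε : ℝ, 0 < ε → ε ≤ ((p : ℝ) - 1) / (2 * (p : ℝ)) →
          ∀ t : ℕ, 1 ≤ t →
            ∀ T : PMF (OnlineTesting.QueryAlg (Fin n → ZMod p) (ZMod p)),
              OnlineTesting.IsOnlineErasureTester t ε
                (OnlineTesting.Hom (Fin n → ZMod p) (ZMod p)) T →
              ∀ q : ℕ, OnlineTesting.MakesAtMost t q T →
                c * Real.logb (p : ℝ) (t : ℝ) ≤ (q : ℝ) := by
  -- `n₀ = 11` works for every prime, as `p ^ 11 ≥ 2 ^ 11 = 2048`.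
  refine ⟨1, one_pos, fun p hp => ⟨11, fun n hn ε _ hε t ht T hT q hq => ?_⟩⟩
  have hp2 : 2 ≤ p := hp.out.two_le
  have hlt : t < p ^ q := by
    by_contra hle
    have hH : OnlineTesting.Hom (Fin n → ZMod p) (ZMod p) =
        OnlineTesting.linearFunctionals (ZMod p) (Fin n → ZMod p) :=
      Set.ext fun h => OnlineTesting.mem_linearFunctionals_iff_mem_Hom.symm
    rw [hH] at hT
    refine OnlineTesting.not_isOnlineErasureTester (by simpa [ZMod.card] using hle) ?_
      (by simpa [ZMod.card] using hε) hq hT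
    rw [Fintype.card_fun, ZMod.card, Fintype.card_fin]
    calc 2048 = 2 ^ 11 := by norm_num
      _ ≤ p ^ 11 := Nat.pow_le_pow_left hp2 _
      _ ≤ p ^ n := Nat.pow_le_pow_right (by omega) hn
  have hp1 : (1 : ℝ) < p := by exact_mod_cast hp2
  rw [one_mul, Real.logb_le_iff_le_rpow hp1 (by exact_mod_cast ht), Real.rpow_natCast]
  exact_mod_cast hlt.le
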